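/- Let $a$ be a positive integer which is either equal to $1$ or not of the form $q^k$ with $q\in\mathbb{Q}$ and $k\ge 2$. For $N\ge 1$ let $\mathbb{Q}_a(N)\subset\mathbb{C}$ be the field obtained by adjoining to $\mathbb{Q}$ all complex roots of $X^N-a$. For integers $n\ge1$, $k\ge0$ put $\zeta_n=e^{2\pi i/n}$ and let $\sqrt[n]{a^k}$ denote the positive real $n$-th root of $a^k$. For $N=p_1^{e_1}\cdots p_s^{e_s}$ with primes $p_1<\dots<p_s$ and $a\neq 1$ define $$\Delta_a(N)=\left|\mathrm{Nm}_{\mathbb{Q}_a(N)/\mathbb{Q}}\left(\prod_{i=1}^{s}\prod_{t=1}^{e_i}\mathrm{disc}_{\mathbb{Q}_a(p_1^{e_1}\cdots p_{i-1}^{e_{i-1}}p_i^{t})/\mathbb{Q}_a(p_1^{e_1}\cdots p_{i-1}^{e_{i-1}}p_i^{t-1})}\bigl(\{\zeta_{p_i^t}^{l}\sqrt[p_i^t]{a^k}\}_{l,k}\bigr)\right)\right|,$$ where $0\le k\le p_i-1$, and $0\le l\le p_i-2$ if $t=1$, $0\le l\le p_i-1$ if $t\ge2$; the discriminant of a finite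 family is the determinant of its trace matrix. For $a=1$ put $\Delta_1(N)=1$. For $\beta\in\mathbb{Q}_a(N)$ let $M_{a,N}(\beta)$ be the least $n\ge 0$ such that $\Delta_a(N)\beta$ is a sum of $n$ terms (counted with repetition), each of the form $\xi\sqrt[N]{a^j}$ with $\xi$ a root of unity and $0\le j\le N-1$. For an algebraic number $x$ let $\mathcal{M}(x)$ be the mean of $|x'|^2$ over all conjugates $x'$ of $x$ over $\mathbb{Q}$. **Lemma 5.2.** Let $\mu\ge 0$, let $N=p_1p_2\cdots p_\mu$ be the product of the first $\mu$ odd primes (so $N=1$ if $\mu=0$), and let $\beta$ be an algebraic integer in $\mathbb{Q}_a(N)$. Then $\Delta_a(N)\beta$ is a sum of finitely many terms of the above form, so that $M_{a,N}(\beta)$ is defined, and $$\Delta_a(N)^2\,\mathcal{M}(\beta)\ \ge\ 2^{-\mu}M_{a,N}(\beta).$$ -/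

import Mathlib

namespace Kummer

noncomputable section

/-- The field `ℚ_a(N)`, obtained by adjoining all the complex roots of `X ^ N - a` to `ℚ`. -/
def Qa (a N : ℕ) : IntermediateField ℚ ℂ :=
  IntermediateField.adjoin ℚ {z : ℂ | z ^ N = (a : ℂ)}

/-- The primitive `n`-th root of unity `exp (2πi / n)`; these satisfy
`zeta m = zeta N ^ (N / m)` for `m ∣ N`, `N ≠ 0`. -/
def zeta (n : ℕ) : ℂ := Complex.exp (2 * Real.pi * Complex.I / n)

/-- The positive real `n`-th root of `a ^ k`. -/
def realRoot (a n k : ℕ) : ℝ := (a : ℝ) ^ ((k : ℝ) / (n : ℝ))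

theorem Qa_mono (a : ℕ) {m n : ℕ} (h : m ∣ n) (hn : n ≠ 0) : Qa a m ≤ Qa a n := by
  obtain ⟨d, rfl⟩ := h
  have hd : d ≠ 0 := by rintro rfl; simp at hn
  refine IntermediateField.adjoin_le_iff.2 ?_
  intro x hx
  obtain ⟨y, rfl⟩ := IsAlgClosed.exists_pow_nat_eq x (Nat.pos_of_ne_zero hd)
  refine pow_mem (IntermediateField.subset_adjoin ℚ _ ?_) d
  have hx' : (y ^ d) ^ m = (a : ℂ) := hx
  change y ^ (m * d) = (a : ℂ)
  rw [← hx', ← pow_mul, mul_comm]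

theorem realRoot_one_mem (a : ℕ) {n : ℕ} (hn : n ≠ 0) :
    ((realRoot a n 1 : ℝ) : ℂ) ∈ Qa a n := by
  refine IntermediateField.subset_adjoin ℚ _ ?_
  change ((realRoot a n 1 : ℝ) : ℂ) ^ n = (a : ℂ)
  have h : realRoot a n 1 ^ n = (a : ℝ) := by
    simp only [realRoot, Nat.cast_one, one_div]
    exact Real.rpow_inv_natCast_pow (Nat.cast_nonneg a) hn
  exact_mod_cast h

theorem realRoot_mem (a : ℕ) {n : ℕ} (hn : n ≠ 0) (k : ℕ) :
    ((realRoot a n k : ℝ) : ℂ) ∈ Qa a n := by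
  have h : realRoot a n k = realRoot a n 1 ^ k := by
    simp only [realRoot, Nat.cast_one]
    rw [← Real.rpow_natCast, ← Real.rpow_mul (Nat.cast_nonneg a)]
    congr 1
    ring
  rw [h]
  push_cast
  exact pow_mem (realRoot_one_mem a hn) k

theorem zeta_mem (a : ℕ) [NeZero a] {n : ℕ} (hn : n ≠ 0) : zeta n ∈ Qa a n := by
  have hr := realRoot_one_mem a hn
  have ha : (0 : ℝ) < a := Nat.cast_pos.2 (Nat.pos_of_ne_zero (NeZero.ne a))
  have hr0 : ((realRoot a n 1 : ℝ) : ℂ) ≠ 0 := by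
    exact_mod_cast (Real.rpow_pos_of_pos ha _).ne'
  have hz : zeta n ^ n = 1 := (Complex.isPrimitiveRoot_exp n hn).pow_eq_one
  have hrn : ((realRoot a n 1 : ℝ) : ℂ) ^ n = (a : ℂ) := by
    have h : realRoot a n 1 ^ n = (a : ℝ) := by
      simp only [realRoot, Nat.cast_one, one_div]
      exact Real.rpow_inv_natCast_pow (Nat.cast_nonneg a) hn
    exact_mod_cast h
  have hzr : zeta n * ((realRoot a n 1 : ℝ) : ℂ) ∈ Qa a n := by
    refine IntermediateField.subset_adjoin ℚ _ ?_
    change (zeta n * ((realRoot a n 1 : ℝ) : ℂ)) ^ n = (a : ℂ)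
    rw [mul_pow, hz, hrn, one_mul]
  have := div_mem hzr hr
  rwa [mul_div_cancel_right₀ _ hr0] at this

/-- The index set of the family `ζ_{p^t}^l · (a^k)^{1/p^t}`: here `0 ≤ k ≤ p - 1`, and
`0 ≤ l ≤ p - 2` if `t = 1`, while `0 ≤ l ≤ p - 1` if `t ≥ 2`. -/
abbrev StepIndex (p t : ℕ) : Type := Fin (if t = 1 then p - 1 else p) × Fin p

/-- The family `ζ_{p^t}^l · (a^k)^{1/p^t}`, as elements of `ℚ_a(n)` where `p ^ t ∣ n`. -/
def stepFamily (a p t : ℕ) [NeZero a] {n : ℕ} (h : p ^ t ∣ n) (hn : n ≠ 0) :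
    StepIndex p t → Qa a n :=
  fun i => ⟨zeta (p ^ t) ^ (i.1 : ℕ) * ((realRoot a (p ^ t) i.2 : ℝ) : ℂ),
    Qa_mono a h hn (mul_mem (pow_mem (zeta_mem a (ne_zero_of_dvd_ne_zero hn h)) _)
      (realRoot_mem a (ne_zero_of_dvd_ne_zero hn h) _))⟩

/-- The discriminant `disc_{L/K}(b)` (determinant of the trace matrix) of a finite family `b` of
elements of `L`, for subfields `K ≤ L` of `ℂ`. -/
def relDisc {K L : IntermediateField ℚ ℂ} (h : K ≤ L) {ι : Type} [Fintype ι] [DecidableEq ι]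
    (b : ι → L) : K :=
  Algebra.discr K (fun i => (⟨(b i : ℂ), (b i).2⟩ : IntermediateField.extendScalars h))

/-- The product of the prime powers `q ^ v_q(N)` over the primes `q ∣ N` with `q < p`. -/
def below (N p : ℕ) : ℕ := ∏ q ∈ N.primeFactors with q < p, q ^ N.factorization q

theorem below_mul_pow_dvd {N p t : ℕ} (hp : p ∈ N.primeFactors) (ht : t ≤ N.factorization p) :
    below N p * p ^ t ∣ N := by
  have hN : N ≠ 0 := (Nat.mem_primeFactors.1 hp).2.2
  have h1 : below N p * p ^ N.factorization p ∣ N := by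
    have hnot : p ∉ N.primeFactors.filter (· < p) := by simp
    have h2 : below N p * p ^ N.factorization p
        = ∏ q ∈ insert p (N.primeFactors.filter (· < p)), q ^ N.factorization q := by
      rw [Finset.prod_insert hnot, mul_comm]
      rfl
    rw [h2]
    conv_rhs => rw [← Nat.prod_factorization_pow_eq_self hN]
    refine Finset.prod_dvd_prod_of_subset _ _ _ ?_
    intro q hq
    rcases Finset.mem_insert.1 hq with rfl | hq
    · simpa using hp
    · simpa using (Finset.mem_filter.1 hq).1
  exact (mul_dvd_mul_left _ (pow_dvd_pow p ht)).trans h1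

/-- For a prime `p ∣ N` and `0 ≤ s < v_p(N)`, with `m = below N p * p ^ s`: the discriminant
`disc_{ℚ_a(m p) / ℚ_a(m)}` of the family `ζ_{p^t}^l · (a^k)^{1/p^t}`, `t = s + 1`. -/
def stepDisc (a N : ℕ) [NeZero a] (p : N.primeFactors) (s : Fin (N.factorization p)) :
    Qa a (below N p * (p : ℕ) ^ (s : ℕ)) :=
  have hn : below N p * (p : ℕ) ^ ((s : ℕ) + 1) ≠ 0 :=
    ne_zero_of_dvd_ne_zero (Nat.mem_primeFactors.1 p.2).2.2 (below_mul_pow_dvd p.2 s.2)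
  relDisc
    (Qa_mono a (mul_dvd_mul_left (below N p) (pow_dvd_pow (p : ℕ) (Nat.le_succ (s : ℕ)))) hn)
    (stepFamily a p ((s : ℕ) + 1) (Dvd.intro_left (below N p) rfl) hn)

/-- The product of all the discriminants in the tower
`ℚ = ℚ_a(1) ⊆ ℚ_a(p₁) ⊆ ℚ_a(p₁²) ⊆ ⋯ ⊆ ℚ_a(N)`, as an element of `ℚ_a(N)`. -/
def discProd (a N : ℕ) [NeZero a] : Qa a N :=
  ∏ p : N.primeFactors, ∏ s : Fin (N.factorization p),
    IntermediateField.inclusion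
      (Qa_mono a (below_mul_pow_dvd p.2 s.2.le) (Nat.mem_primeFactors.1 p.2).2.2)
      (stepDisc a N p s)

/-- `Δ_a(N)`: the absolute value of the norm from `ℚ_a(N)` to `ℚ` of the product of the
discriminants in the tower; for `a = 1` the convention is `Δ_1(N) = 1`. -/
def Delta (a N : ℕ) [NeZero a] : ℚ :=
  if a = 1 then 1 else |Algebra.norm ℚ (discProd a N)|

/-- `Δ_a(N) β` is a sum of `n` terms, counted with repetition, each of the form `ξ α` with `ξ` a
root of unity and `α` the positive real `N`-th root of `a ^ j` for some `0 ≤ j < N`. -/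
def IsSumOfRoots (a N : ℕ) [NeZero a] (β : ℂ) (n : ℕ) : Prop :=
  ∃ (ξ : Fin n → ℂ) (j : Fin n → Fin N), (∀ i, ∃ k : ℕ, 0 < k ∧ ξ i ^ k = 1) ∧
    (Delta a N : ℂ) * β = ∑ i, ξ i * ((realRoot a N (j i) : ℝ) : ℂ)

/-- `M_{a,N}(β)`: the least number of terms in such a sum. -/
def M (a N : ℕ) [NeZero a] (β : ℂ) : ℕ := sInf {n : ℕ | IsSumOfRoots a N β n}

/-- `𝓜(x)`: the mean of `|x'|²` over the conjugates `x'` of the algebraic number `x`. -/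
def meanSq (x : ℂ) : ℝ :=
  (((minpoly ℚ x).aroots ℂ).map (fun z => ‖z‖ ^ 2)).sum / ((minpoly ℚ x).natDegree : ℝ)

end

end Kummer

/-! If `Δ = Δ_a(N)` vanishes, there is nothing to prove. Let `Δ ≠ 0` and, for the first reduction,
`a ≠ 1`. By Cramer's rule, multiplication by the discriminant of a step of the tower
`ℚ = ℚ_a(1) ⊆ ⋯ ⊆ ℚ_a(N)` clears the denominators at that step, so that
`Δβ = ∑_{j<N} P_j(ζ_N) a^{j/N}` with `P_j ∈ ℤ[X]`. As these discriminants are nonzero, their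
families are bases, so that `[ℚ_a(N) : ℚ] = φ(N)N` is as large as possible. The embeddings of
`ℚ_a(N)` are then all the pairs of a primitive `N`-th root of unity and an `N`-th root of unity, and
orthogonality of the latter gives `𝓜(Δβ) = ∑_j a^{2j/N} 𝓜(P_j(ζ_N)) ≥ ∑_j 𝓜(P_j(ζ_N))`.

It remains to write each cyclotomic integer `P(ζ_N)`, for squarefree `N`, as a sum of at most
`2^{ω(N)} 𝓜(P(ζ_N))` roots of unity. Following Cassels, one removes a prime `q` from `N = mq`
by splitting `P(xy) = ∑_{j<q} A_j(x) y^j`, with `y` a primitive `q`-th root of unity. As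
`∑_j y^j = 0`, every `A_j` may be replaced by `A_j - A_i`. The mean over `y` of `|P(xy)|²` is
`∑_{i,j} |A_j(x) - A_i(x)|² / (2(q - 1))`, so a suitable `i` costs at most a factor `2`. -/

namespace Kummer

open Finset Polynomial IntermediateField Module

/-- `x` is a sum of `n` elements of `S`, counted with repetition. -/
def IsSumOf {A : Type*} [AddCommMonoid A] (S : Set A) (n : ℕ) (x : A) : Prop :=
  ∃ s : Multiset A, (∀ y ∈ s, y ∈ S) ∧ s.card = n ∧ s.sum = x

namespace IsSumOf

theorem sum {A ι : Type*} [AddCommMonoid A] {S : Set A} {t : Finset ι} {n : ι → ℕ} {x : ι → A}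
    (h : ∀ i, IsSumOf S (n i) (x i)) : IsSumOf S (∑ i ∈ t, n i) (∑ i ∈ t, x i) := by
  choose s hs hcard hsum using h
  refine ⟨∑ i ∈ t, s i, fun y hy => ?_, by simp only [Multiset.card_sum, hcard], ?_⟩
  · obtain ⟨i, -, hy⟩ := Multiset.mem_sum.1 hy
    exact hs i y hy
  · rw [← Multiset.coe_sumAddMonoidHom, map_sum]
    exact sum_congr rfl fun i _ => hsum i

theorem map {A B F : Type*} [AddCommMonoid A] [AddCommMonoid B] [FunLike F A B]
    [AddMonoidHomClass F A B] {S : Set A} {T : Set B} {n : ℕ} {x : A} (h : IsSumOf S n x) (f : F)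
    (hf : Set.MapsTo f S T) : IsSumOf T n (f x) := by
  obtain ⟨s, hs, rfl, rfl⟩ := h
  refine ⟨s.map f, fun y hy => ?_, Multiset.card_map f s, (map_multiset_sum f s).symm⟩
  obtain ⟨x, hx, rfl⟩ := Multiset.mem_map.1 hy
  exact hf (hs x hx)

theorem intCast {R : Type*} [Ring R] {S : Set R} (h1 : 1 ∈ S) (hneg : -1 ∈ S) (c : ℤ) :
    IsSumOf S c.natAbs (c : R) := by
  obtain ⟨k, rfl | rfl⟩ := c.eq_nat_or_neg
  · exact ⟨Multiset.replicate k 1, fun y hy => Multiset.eq_of_mem_replicate hy ▸ h1, by simp⟩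
  · exact ⟨Multiset.replicate k (-1), fun y hy => Multiset.eq_of_mem_replicate hy ▸ hneg, by simp⟩

theorem exists_fin {A : Type*} [AddCommMonoid A] {S : Set A} {n : ℕ} {x : A} (h : IsSumOf S n x) :
    ∃ y : Fin n → A, (∀ i, y i ∈ S) ∧ ∑ i, y i = x := by
  obtain ⟨s, hs, rfl, rfl⟩ := h
  induction s using Quotient.inductionOn with
  | h l => exact ⟨l.get, fun i => hs _ (l.get_mem i), Fin.sum_univ_getElem l⟩

end IsSumOf

section RootsOfUnity

theorem sum_nthRootsFinset_zpow {K : Type*} [Field K] {n : ℕ} (hn : 0 < n) {ζ : K}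
    (hζ : IsPrimitiveRoot ζ n) (e : ℤ) :
    ∑ y ∈ nthRootsFinset n (1 : K), y ^ e = if (n : ℤ) ∣ e then (n : K) else 0 := by
  split_ifs with h
  · have hone : ∀ y ∈ nthRootsFinset n (1 : K), y ^ e = 1 := by
      intro y hy
      obtain ⟨d, rfl⟩ := h
      rw [zpow_mul, zpow_natCast, (mem_nthRootsFinset hn 1).1 hy, one_zpow]
    rw [sum_congr rfl hone]
    simp [hζ.card_nthRootsFinset]
  · have hshift : ∑ y ∈ nthRootsFinset n (1 : K), (ζ * y) ^ e
        = ∑ y ∈ nthRootsFinset n (1 : K), y ^ e :=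
      sum_equiv (Equiv.mulLeft₀ ζ (hζ.ne_zero hn.ne'))
        (fun y => by simp [mem_nthRootsFinset hn, mul_pow, hζ.pow_eq_one]) fun _ _ => rfl
    simp only [mul_zpow, ← mul_sum] at hshift
    exact (mul_left_eq_self₀.1 hshift).resolve_left fun h1 => h ((hζ.zpow_eq_one_iff_dvd e).1 h1)

theorem sum_nthRootsFinset_norm_sq {n : ℕ} (hn : 0 < n) (α : Fin n → ℂ) :
    ∑ y ∈ nthRootsFinset n (1 : ℂ), ‖∑ j, α j * y ^ (j : ℕ)‖ ^ 2 = n * ∑ j, ‖α j‖ ^ 2 := by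
  have hexpand : ∀ y ∈ nthRootsFinset n (1 : ℂ),
      ((‖∑ j, α j * y ^ (j : ℕ)‖ ^ 2 : ℝ) : ℂ)
        = ∑ j, ∑ k, α j * (starRingEnd ℂ) (α k) * y ^ ((j : ℤ) - (k : ℤ)) := by
    intro y hy
    have hy1 := (mem_nthRootsFinset hn 1).1 hy
    have hconj : (starRingEnd ℂ) y = y⁻¹ :=
      (Complex.inv_eq_conj (Complex.norm_eq_one_of_pow_eq_one hy1 hn.ne')).symm
    have hy0 : y ≠ 0 := ne_zero_of_mem_nthRootsFinset one_ne_zero hy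
    rw [Complex.ofReal_pow, ← Complex.mul_conj', map_sum, sum_mul_sum]
    refine sum_congr rfl fun j _ => sum_congr rfl fun k _ => ?_
    rw [map_mul, map_pow, hconj, zpow_sub₀ hy0, zpow_natCast, zpow_natCast]
    ring
  have hdvd : ∀ j k : Fin n, (n : ℤ) ∣ (j : ℤ) - (k : ℤ) ↔ j = k := by
    intro j k
    rw [← Int.modEq_iff_dvd, Int.natCast_modEq_iff, Nat.ModEq, Nat.mod_eq_of_lt j.2,
      Nat.mod_eq_of_lt k.2, Fin.ext_iff, eq_comm]
  have horth : ∀ j k : Fin n,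
      ∑ y ∈ nthRootsFinset n (1 : ℂ), α j * (starRingEnd ℂ) (α k) * y ^ ((j : ℤ) - (k : ℤ))
        = if j = k then (n : ℂ) * ‖α j‖ ^ 2 else 0 := by
    intro j k
    rw [← mul_sum, sum_nthRootsFinset_zpow hn (Complex.isPrimitiveRoot_exp n hn.ne')]
    simp only [hdvd]
    split_ifs with h
    · rw [h, Complex.mul_conj', mul_comm]
    · rw [mul_zero]
  apply Complex.ofReal_injective
  rw [Complex.ofReal_sum, sum_congr rfl hexpand, sum_comm]
  push_cast
  rw [mul_sum]
  refine sum_congr rfl fun j _ => ?_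
  rw [sum_comm]
  simp [horth]

theorem sum_sum_norm_sub_sq {E ι : Type*} [NormedAddCommGroup E] [InnerProductSpace ℝ E] [Fintype ι]
    (α : ι → E) :
    ∑ i, ∑ j, ‖α j - α i‖ ^ 2
      = 2 * (Fintype.card ι * ∑ j, ‖α j‖ ^ 2 - ‖∑ j, α j‖ ^ 2) := by
  have hinner : ∑ i, ∑ j, inner ℝ (α j) (α i) = ‖∑ j, α j‖ ^ 2 := by
    rw [← real_inner_self_eq_norm_sq, sum_inner, sum_comm]
    simp only [inner_sum]
  simp only [norm_sub_sq_real, sum_add_distrib, sum_sub_distrib, sum_const, ← mul_sum, hinner,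
    card_univ, nsmul_eq_mul]
  ring

theorem two_mul_sum_primitiveRoots_norm_sq {p : ℕ} (hp : p.Prime) (α : Fin p → ℂ) :
    2 * ∑ y ∈ primitiveRoots p ℂ, ‖∑ j, α j * y ^ (j : ℕ)‖ ^ 2
      = ∑ i, ∑ j, ‖α j - α i‖ ^ 2 := by
  have hdisj : Disjoint (primitiveRoots p ℂ) {1} := by
    rw [disjoint_singleton_right]
    exact fun h => (isPrimitiveRoot_of_mem_primitiveRoots h).ne_one hp.one_lt rfl
  have hparseval := sum_nthRootsFinset_norm_sq hp.pos α
  rw [nthRootsFinset_eq_of_prime hp, sum_union hdisj, sum_singleton] at hparseval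
  simp only [one_pow, mul_one] at hparseval
  rw [sum_sum_norm_sub_sq, Fintype.card_fin, ← hparseval, add_sub_cancel_right]

end RootsOfUnity

section CoprimeRoots

variable {R : Type*} [CommRing R] [IsDomain R] {m n : ℕ}

theorem mul_mem_primitiveRoots (hm : 0 < m) (hn : 0 < n) (h : m.Coprime n) {x y : R}
    (hx : x ∈ primitiveRoots m R) (hy : y ∈ primitiveRoots n R) :
    x * y ∈ primitiveRoots (m * n) R := by
  rw [mem_primitiveRoots hm] at hx
  rw [mem_primitiveRoots hn] at hy
  rw [mem_primitiveRoots (Nat.mul_pos hm hn), IsPrimitiveRoot.iff_orderOf,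
    (Commute.all x y).orderOf_mul_eq_mul_orderOf_of_coprime
      (by rwa [← hx.eq_orderOf, ← hy.eq_orderOf]), ← hx.eq_orderOf, ← hy.eq_orderOf]

theorem injOn_mul_primitiveRoots (hm : 0 < m) (hn : 0 < n) (h : m.Coprime n) :
    Set.InjOn (fun q : R × R => q.1 * q.2)
      (primitiveRoots m R ×ˢ primitiveRoots n R : Finset (R × R)) := by
  obtain ⟨e, hem, hen⟩ := Nat.chineseRemainder h 1 0
  have hfst : ∀ q ∈ primitiveRoots m R ×ˢ primitiveRoots n R, (q.1 * q.2) ^ e = q.1 := by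
    intro q hq
    rw [mem_product, mem_primitiveRoots hm, mem_primitiveRoots hn] at hq
    rw [mul_pow, pow_eq_pow_of_modEq hem hq.1.pow_eq_one,
      pow_eq_pow_of_modEq hen hq.2.pow_eq_one, pow_one, pow_zero, mul_one]
  intro q hq q' hq' heq
  have hq1 : q.1 = q'.1 := by
    rw [← hfst q hq, ← hfst q' hq']
    exact congrArg (· ^ e) heq
  have hq0 : q.1 ≠ 0 := by
    rw [mem_coe, mem_product, mem_primitiveRoots hm] at hq
    exact hq.1.ne_zero hm.ne'
  simp only [← hq1] at heq
  exact Prod.ext hq1 (mul_left_cancel₀ hq0 heq)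

theorem image_mul_primitiveRoots [DecidableEq R] (hm : 0 < m) (hn : 0 < n) (h : m.Coprime n)
    {ζ : R} (hζ : IsPrimitiveRoot ζ (m * n)) :
    (primitiveRoots m R ×ˢ primitiveRoots n R).image (fun q => q.1 * q.2)
      = primitiveRoots (m * n) R := by
  have hmn := Nat.mul_pos hm hn
  refine eq_of_subset_of_card_le (fun z hz => ?_) ?_
  · obtain ⟨q, hq, rfl⟩ := mem_image.1 hz
    exact mul_mem_primitiveRoots hm hn h (mem_product.1 hq).1 (mem_product.1 hq).2
  · rw [card_image_of_injOn (injOn_mul_primitiveRoots hm hn h), card_product,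
      hζ.card_primitiveRoots, (hζ.pow hmn (mul_comm m n)).card_primitiveRoots,
      (hζ.pow hmn rfl).card_primitiveRoots, Nat.totient_mul h]

theorem sum_primitiveRoots_mul {M : Type*} [AddCommMonoid M] (hm : 0 < m) (hn : 0 < n)
    (h : m.Coprime n) {ζ : R} (hζ : IsPrimitiveRoot ζ (m * n)) (f : R → M) :
    ∑ z ∈ primitiveRoots (m * n) R, f z
      = ∑ x ∈ primitiveRoots m R, ∑ y ∈ primitiveRoots n R, f (x * y) := by
  classical
  rw [← image_mul_primitiveRoots hm hn h hζ, sum_image (injOn_mul_primitiveRoots hm hn h),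
    sum_product]

end CoprimeRoots

section ResiduePart

variable {R : Type*} [CommRing R]

/-- The part of the polynomial `P` formed by the exponents congruent to `j` modulo `p`. -/
noncomputable def residuePart (p : ℕ) (P : R[X]) (j : Fin p) : R[X] :=
  ∑ k ∈ P.support with k % p = (j : ℕ), monomial k (P.coeff k)

theorem aeval_mul_eq_sum_residuePart {A : Type*} [CommRing A] [Algebra R A] {p : ℕ} (hp : 0 < p)
    (P : R[X]) (x : A) {y : A} (hy : y ^ p = 1) :
    aeval (x * y) P = ∑ j, aeval x (residuePart p P j) * y ^ (j : ℕ) := by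
  have hpart : ∀ j : Fin p, aeval x (residuePart p P j) * y ^ (j : ℕ)
      = ∑ k ∈ P.support with (⟨k % p, Nat.mod_lt k hp⟩ : Fin p) = j,
          algebraMap R A (P.coeff k) * (x * y) ^ k := by
    intro j
    simp only [residuePart, map_sum, aeval_monomial, sum_mul, Fin.ext_iff]
    refine sum_congr rfl fun k hk => ?_
    rw [← (mem_filter.1 hk).2, mul_pow, ← pow_eq_pow_mod k hy, mul_assoc]
  rw [sum_congr rfl fun j _ => hpart j, sum_fiberwise, aeval_def, eval₂_eq_sum, Polynomial.sum_def]

end ResiduePart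

section Cassels

/-- The sum of `|P(w)|²` over the primitive `n`-th roots of unity `w`, that is, `φ(n)` times the
mean square of the algebraic number `P(ζ_n)`. -/
noncomputable def conjSqSum (n : ℕ) (P : ℤ[X]) : ℝ :=
  ∑ w ∈ primitiveRoots n ℂ, ‖aeval w P‖ ^ 2

theorem conjSqSum_nonneg (n : ℕ) (P : ℤ[X]) : 0 ≤ conjSqSum n P :=
  sum_nonneg fun _ _ => sq_nonneg _

variable {m q : ℕ}

theorem two_mul_conjSqSum_mul (hm : 0 < m) (hq : q.Prime) (h : m.Coprime q) (P : ℤ[X]) :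
    2 * conjSqSum (m * q) P
      = ∑ i, ∑ j, conjSqSum m (residuePart q P j - residuePart q P i) := by
  have hfibre : ∀ w : ℂ, 2 * ∑ y ∈ primitiveRoots q ℂ, ‖aeval (w * y) P‖ ^ 2
      = ∑ i, ∑ j, ‖aeval w (residuePart q P j - residuePart q P i)‖ ^ 2 := by
    intro w
    simp only [map_sub]
    rw [← two_mul_sum_primitiveRoots_norm_sq hq]
    refine congrArg _ (sum_congr rfl fun y hy => ?_)
    rw [aeval_mul_eq_sum_residuePart hq.pos P w
      (isPrimitiveRoot_of_mem_primitiveRoots hy).pow_eq_one]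
  have hζ := Complex.isPrimitiveRoot_exp (m * q) (Nat.mul_pos hm hq.pos).ne'
  simp only [conjSqSum]
  rw [sum_primitiveRoots_mul hm hq.pos h hζ, mul_sum]
  simp only [hfibre]
  rw [sum_comm]
  exact sum_congr rfl fun i _ => sum_comm

theorem exists_sum_conjSqSum_sub_le (hm : 0 < m) (hq : q.Prime) (h : m.Coprime q) (P : ℤ[X]) :
    ∃ i, q * ∑ j, conjSqSum m (residuePart q P j - residuePart q P i)
      ≤ 2 * conjSqSum (m * q) P := by
  have : NeZero q := ⟨hq.ne_zero⟩
  by_contra! hlt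
  have hsum := sum_lt_sum_of_nonempty univ_nonempty fun i _ => hlt i
  rw [← mul_sum _ _ (q : ℝ), ← two_mul_conjSqSum_mul hm hq h, sum_const, card_univ,
    Fintype.card_fin, nsmul_eq_mul] at hsum
  exact hsum.false

theorem aeval_mul_eq_sum_sub {R A : Type*} [CommRing R] [CommRing A] [IsDomain A] [Algebra R A]
    (hq : 1 < q) (P : R[X]) (x : A) {y : A} (hy : IsPrimitiveRoot y q) (i : Fin q) :
    aeval (x * y) P
      = ∑ j : Fin q, y ^ (j : ℕ) * aeval x (residuePart q P j - residuePart q P i) := by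
  have hgeom : ∑ j : Fin q, y ^ (j : ℕ) = 0 := by
    rw [Fin.sum_univ_eq_sum_range (fun j => y ^ j), hy.geom_sum_eq_zero hq]
  simp only [map_sub, mul_sub, sum_sub_distrib, ← sum_mul, hgeom, zero_mul, sub_zero]
  rw [aeval_mul_eq_sum_residuePart (zero_lt_one.trans hq) P x hy.pow_eq_one]
  exact sum_congr rfl fun j _ => mul_comm _ _

theorem isSumOf_intCast_natAbs (c : ℤ) : IsSumOf {ξ : ℂ | IsOfFinOrder ξ} c.natAbs (c : ℂ) :=
  IsSumOf.intCast (S := {ξ : ℂ | IsOfFinOrder ξ}) .one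
    (isOfFinOrder_iff_pow_eq_one.2 ⟨2, two_pos, neg_one_sq⟩) c

/-- Writing `P(xy)`, with `y` a primitive `q`-th root of unity, as `∑ⱼ yʲ (Aⱼ(x) - Aᵢ(x))` for the
best of the `q` choices of `i` loses only a factor `2`. -/
theorem exists_isSumOf_rootsOfUnity_mul (hm : 0 < m) (hq : q.Prime) (h : m.Coprime q) {k : ℕ}
    (ih : ∀ (A : ℤ[X]) {x : ℂ}, x ∈ primitiveRoots m ℂ →
      ∃ n : ℕ, IsSumOf {ξ : ℂ | IsOfFinOrder ξ} n (aeval x A) ∧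
        (n : ℝ) * m.totient ≤ 2 ^ k * conjSqSum m A)
    (P : ℤ[X]) {z : ℂ} (hz : z ∈ primitiveRoots (m * q) ℂ) :
    ∃ n : ℕ, IsSumOf {ξ : ℂ | IsOfFinOrder ξ} n (aeval z P) ∧
      (n : ℝ) * (m * q).totient ≤ 2 ^ (k + 1) * conjSqSum (m * q) P := by
  have hζ := Complex.isPrimitiveRoot_exp (m * q) (Nat.mul_pos hm hq.pos).ne'
  rw [← image_mul_primitiveRoots hm hq.pos h hζ] at hz
  obtain ⟨⟨x, y⟩, hxy, rfl⟩ := mem_image.1 hz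
  obtain ⟨hx, hy⟩ := mem_product.1 hxy
  have hy' := isPrimitiveRoot_of_mem_primitiveRoots hy
  obtain ⟨i, hi⟩ := exists_sum_conjSqSum_sub_le hm hq h P
  choose n hn hle using fun j => ih (residuePart q P j - residuePart q P i) hx
  refine ⟨∑ j, n j, ?_, ?_⟩
  · rw [aeval_mul_eq_sum_sub hq.one_lt P x hy' i]
    refine IsSumOf.sum fun j => (hn j).map (AddMonoidHom.mulLeft (y ^ (j : ℕ))) fun ξ hξ => ?_
    exact ((hy'.isOfFinOrder hq.ne_zero).pow).mul hξ
  · have hsum : (∑ j, n j : ℕ) * (m.totient : ℝ)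
        ≤ 2 ^ k * ∑ j, conjSqSum m (residuePart q P j - residuePart q P i) := by
      rw [Nat.cast_sum, sum_mul, mul_sum]
      exact sum_le_sum fun j _ => hle j
    have hnonneg : 0 ≤ 2 ^ k * ∑ j, conjSqSum m (residuePart q P j - residuePart q P i) :=
      mul_nonneg (by positivity) (sum_nonneg fun _ _ => conjSqSum_nonneg _ _)
    have hq1 : ((q - 1 : ℕ) : ℝ) ≤ q := Nat.cast_le.2 (Nat.sub_le q 1)
    calc (∑ j, n j : ℕ) * ((m * q).totient : ℝ)
        = (∑ j, n j : ℕ) * (m.totient : ℝ) * (q - 1 : ℕ) := by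
          rw [Nat.totient_mul h, Nat.totient_prime hq, Nat.cast_mul, mul_assoc]
      _ ≤ (2 ^ k * ∑ j, conjSqSum m (residuePart q P j - residuePart q P i)) * q := by gcongr
      _ = 2 ^ k * (q * ∑ j, conjSqSum m (residuePart q P j - residuePart q P i)) := by ring
      _ ≤ 2 ^ k * (2 * conjSqSum (m * q) P) := by gcongr
      _ = 2 ^ (k + 1) * conjSqSum (m * q) P := by ring

theorem exists_isSumOf_rootsOfUnity {N : ℕ} (hN : Squarefree N) (P : ℤ[X]) {z : ℂ}
    (hz : z ∈ primitiveRoots N ℂ) :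
    ∃ n : ℕ, IsSumOf {ξ : ℂ | IsOfFinOrder ξ} n (aeval z P) ∧
      (n : ℝ) * N.totient ≤ 2 ^ #N.primeFactors * conjSqSum N P := by
  induction N using induction_on_primes generalizing P z with
  | zero => exact absurd hN not_squarefree_zero
  | one =>
    rw [IsPrimitiveRoot.primitiveRoots_one, mem_singleton] at hz
    subst hz
    have heval : aeval (1 : ℂ) P = (P.eval 1 : ℤ) := by
      simpa using aeval_algebraMap_apply ℂ (1 : ℤ) P
    refine ⟨(P.eval 1).natAbs, heval ▸ isSumOf_intCast_natAbs _, ?_⟩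
    rw [conjSqSum, IsPrimitiveRoot.primitiveRoots_one, sum_singleton, heval, Complex.norm_intCast,
      sq_abs, Nat.cast_natAbs, Nat.totient_one, Nat.primeFactors_one, card_empty, Nat.cast_one,
      mul_one, pow_zero, one_mul]
    exact_mod_cast Int.natAbs_le_self_sq _
  | prime_mul q m hq ih =>
    rw [mul_comm q m] at hN hz ⊢
    obtain ⟨hmq, hm, -⟩ := Nat.squarefree_mul_iff.1 hN
    rw [hmq.primeFactors_mul, card_union_of_disjoint hmq.disjoint_primeFactors, hq.primeFactors,
      card_singleton]
    exact exists_isSumOf_rootsOfUnity_mul hm.ne_zero.bot_lt hq hmq (ih hm) P hz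

end Cassels

section Embeddings

variable {F K Ω M : Type*} [Field F] [Field K] [Field Ω] [Algebra F K] [Algebra F Ω]
  [FiniteDimensional F K] [Algebra.IsSeparable F K] [AddCommMonoid M]

theorem sum_algHom_adjoin_simple_gen (x : K) (f : Ω → M) :
    ∑ τ : F⟮x⟯ →ₐ[F] Ω, f (τ (AdjoinSimple.gen F x))
      = (((minpoly F x).aroots Ω).map f).sum := by
  classical
  have hx : IsIntegral F x := .of_finite F x
  have hnodup : ((minpoly F x).aroots Ω).Nodup :=
    nodup_roots (Polynomial.Separable.map (Algebra.IsSeparable.isSeparable F x))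
  calc ∑ τ : F⟮x⟯ →ₐ[F] Ω, f (τ (AdjoinSimple.gen F x))
      = ∑ r : {r // r ∈ (minpoly F x).aroots Ω}, f r :=
        Fintype.sum_equiv (algHomAdjoinIntegralEquiv F hx) _ _ fun τ => by
          rw [← algHomAdjoinIntegralEquiv_symm_apply_gen F hx, Equiv.symm_apply_apply]
    _ = ∑ r ∈ ((minpoly F x).aroots Ω).toFinset, f r :=
        (sum_subtype _ (fun r => Multiset.mem_toFinset) f).symm
    _ = (((minpoly F x).aroots Ω).map f).sum := by
        rw [Finset.sum, Multiset.toFinset_val, hnodup.dedup]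

theorem sum_algHom_apply [IsAlgClosed Ω] (x : K) (f : Ω → M) :
    ∑ σ : K →ₐ[F] Ω, f (σ x) = finrank F⟮x⟯ K • (((minpoly F x).aroots Ω).map f).sum := by
  have : Algebra.IsSeparable F⟮x⟯ K := Algebra.isSeparable_tower_top_of_isSeparable F F⟮x⟯ K
  rw [← sum_algHom_adjoin_simple_gen, ← sum_nsmul, Fintype.sum_equiv (algHomEquivSigma (B := F⟮x⟯))
    (fun σ : K →ₐ[F] Ω => f (σ x)) (fun σ => f (σ.1 (AdjoinSimple.gen F x))) fun σ => rfl,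
    Fintype.sum_sigma]
  refine sum_congr rfl fun τ _ => ?_
  let : Algebra F⟮x⟯ Ω := τ.toRingHom.toAlgebra
  rw [← AlgHom.card F⟮x⟯ K Ω]
  exact sum_const (f (τ (AdjoinSimple.gen F x)))

end Embeddings

section MeanSquare

theorem finrank_mul_meanSq (K : IntermediateField ℚ ℂ) [FiniteDimensional ℚ K] (x : K) :
    finrank ℚ K * meanSq x = ∑ σ : K →ₐ[ℚ] ℂ, ‖σ x‖ ^ 2 := by
  have hx : IsIntegral ℚ x := .of_finite ℚ x
  have hdeg : ((minpoly ℚ x).natDegree : ℝ) ≠ 0 := Nat.cast_ne_zero.2 (minpoly.natDegree_pos hx).ne'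
  rw [sum_algHom_apply x (fun z : ℂ => ‖z‖ ^ 2), meanSq,
    show minpoly ℚ (x : ℂ) = minpoly ℚ x from minpoly.algebraMap_eq K.val.injective x,
    ← finrank_mul_finrank ℚ ℚ⟮x⟯ K, adjoin.finrank hx, nsmul_eq_mul, Nat.cast_mul]
  field_simp

theorem meanSq_ratCast_mul (q : ℚ) {x : ℂ} (hx : IsIntegral ℚ x) :
    meanSq (q * x) = (q : ℝ) ^ 2 * meanSq x := by
  have := adjoin.finiteDimensional hx
  let y : ℚ⟮x⟯ := AdjoinSimple.gen ℚ x
  have hrank : (finrank ℚ ℚ⟮x⟯ : ℝ) ≠ 0 := Nat.cast_ne_zero.2 finrank_pos.ne'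
  have hqy : ((algebraMap ℚ ℚ⟮x⟯ q * y : ℚ⟮x⟯) : ℂ) = q * x := rfl
  refine mul_left_cancel₀ hrank ?_
  rw [← hqy, finrank_mul_meanSq, mul_left_comm]
  refine Eq.trans ?_ (congrArg ((q : ℝ) ^ 2 * ·) (finrank_mul_meanSq ℚ⟮x⟯ y).symm)
  rw [mul_sum]
  refine sum_congr rfl fun σ _ => ?_
  rw [map_mul, AlgHom.commutes, norm_mul, mul_pow]
  simp

end MeanSquare

section RadicalExtension

variable {F Ω : Type*} [Field F] [Field Ω] [Algebra F Ω] {n : ℕ} {ζ r : Ω} {b : F}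

variable (F ζ r) in
/-- The generator `ζ` of the field `F(ζ, r)`. -/
def rootGen : adjoin F {ζ, r} := ⟨ζ, subset_adjoin F _ (Set.mem_insert ζ {r})⟩

variable (F ζ r) in
/-- The generator `r` of the field `F(ζ, r)`. -/
def radicalGen : adjoin F {ζ, r} := ⟨r, subset_adjoin F _ (Set.mem_insert_of_mem ζ rfl)⟩

/-- The pair `(σ ζ, σ r / r)` attached to an embedding `σ` of `F(ζ, r)`. If `ζ` is a primitive
`n`-th root of unity and `r ^ n ∈ F`, it consists of a primitive `n`-th root of unity and an `n`-th
root of unity, and it determines `σ`. -/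
def radicalPair (σ : adjoin F {ζ, r} →ₐ[F] Ω) : Ω × Ω :=
  (σ (rootGen F ζ r), σ (radicalGen F ζ r) / r)

theorem finiteDimensional_adjoin_radical (hn : 0 < n) (hζ : IsPrimitiveRoot ζ n)
    (hb : r ^ n = algebraMap F Ω b) : FiniteDimensional F (adjoin F {ζ, r}) := by
  refine finiteDimensional_adjoin fun x hx => ?_
  obtain rfl | rfl := hx
  · exact (hζ.isIntegral hn).tower_top
  · exact .of_pow hn (hb ▸ isIntegral_algebraMap)

theorem radicalPair_mem (hn : 0 < n) (hζ : IsPrimitiveRoot ζ n) (hr : r ≠ 0)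
    (hb : r ^ n = algebraMap F Ω b) (σ : adjoin F {ζ, r} →ₐ[F] Ω) :
    radicalPair σ ∈ primitiveRoots n Ω ×ˢ nthRootsFinset n (1 : Ω) := by
  have hroot : IsPrimitiveRoot (rootGen F ζ r) n :=
    IsPrimitiveRoot.coe_submonoidClass_iff.1 hζ
  have hpow : radicalGen F ζ r ^ n = algebraMap F _ b := Subtype.ext hb
  rw [mem_product, mem_primitiveRoots hn, mem_nthRootsFinset hn]
  refine ⟨hroot.map_of_injective σ.injective, ?_⟩
  rw [radicalPair, div_pow, ← map_pow, hpow, AlgHom.commutes, ← hb, div_self (pow_ne_zero n hr)]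

theorem radicalPair_injective (hr : r ≠ 0) :
    Function.Injective (radicalPair : (adjoin F {ζ, r} →ₐ[F] Ω) → Ω × Ω) := by
  intro σ τ h
  obtain ⟨hroot, hradical⟩ := Prod.ext_iff.1 h
  refine algHom_ext_of_eq_adjoin F rfl fun x hx => ?_
  obtain rfl | rfl := hx
  · exact hroot
  · exact (div_left_inj' hr).1 hradical

theorem card_primitiveRoots_product_nthRootsFinset (hζ : IsPrimitiveRoot ζ n) :
    #(primitiveRoots n Ω ×ˢ nthRootsFinset n (1 : Ω)) = n.totient * n := by
  rw [card_product, hζ.card_primitiveRoots, hζ.card_nthRootsFinset]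

variable [CharZero F] [IsAlgClosed Ω]

theorem finrank_adjoin_radical_le (hn : 0 < n) (hζ : IsPrimitiveRoot ζ n) (hr : r ≠ 0)
    (hb : r ^ n = algebraMap F Ω b) : finrank F (adjoin F {ζ, r}) ≤ n.totient * n := by
  have := finiteDimensional_adjoin_radical hn hζ hb
  rw [← AlgHom.card F (adjoin F {ζ, r}) Ω, ← card_primitiveRoots_product_nthRootsFinset hζ,
    ← card_univ]
  exact card_le_card_of_injOn radicalPair (fun σ _ => radicalPair_mem hn hζ hr hb σ)
    (radicalPair_injective hr).injOn

theorem sum_radicalPair [FiniteDimensional F (adjoin F {ζ, r})] {M : Type*} [AddCommMonoid M]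
    (hn : 0 < n) (hζ : IsPrimitiveRoot ζ n) (hr : r ≠ 0) (hb : r ^ n = algebraMap F Ω b)
    (hdim : n.totient * n ≤ finrank F (adjoin F {ζ, r})) (G : Ω × Ω → M) :
    ∑ σ : adjoin F {ζ, r} →ₐ[F] Ω, G (radicalPair σ)
      = ∑ q ∈ primitiveRoots n Ω ×ˢ nthRootsFinset n (1 : Ω), G q := by
  have hmem : Set.MapsTo radicalPair (univ : Finset (adjoin F {ζ, r} →ₐ[F] Ω))
      (primitiveRoots n Ω ×ˢ nthRootsFinset n (1 : Ω) : Finset (Ω × Ω)) :=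
    fun σ _ => radicalPair_mem hn hζ hr hb σ
  refine sum_nbij radicalPair hmem (radicalPair_injective hr).injOn
    (surjOn_of_injOn_of_card_le _ hmem (radicalPair_injective hr).injOn ?_) fun _ _ => rfl
  rwa [card_primitiveRoots_product_nthRootsFinset hζ, card_univ, AlgHom.card F _ Ω]

end RadicalExtension

section MeanSquareRadical

theorem map_aeval_int {A B : Type*} [CommRing A] [CommRing B] (f : A →+* B) (x : A) (P : ℤ[X]) :
    f (aeval x P) = aeval (f x) P :=
  (aeval_algHom_apply f.toIntAlgHom x P).symm

theorem totient_mul_meanSq_sum_radical {n : ℕ} (hn : 0 < n) {ζ r : ℂ} (hζ : IsPrimitiveRoot ζ n)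
    (hr : r ≠ 0) {b : ℚ} (hb : r ^ n = b)
    (hdim : n.totient * n ≤ finrank ℚ (adjoin ℚ {ζ, r})) (P : Fin n → ℤ[X]) :
    n.totient * meanSq (∑ j : Fin n, aeval ζ (P j) * r ^ (j : ℕ))
      = ∑ j : Fin n, ‖r ^ (j : ℕ)‖ ^ 2 * conjSqSum n (P j) := by
  have := finiteDimensional_adjoin_radical hn hζ (F := ℚ) hb
  let z := rootGen ℚ ζ r
  let ρ := radicalGen ℚ ζ r
  let x : adjoin ℚ {ζ, r} := ∑ j : Fin n, aeval z (P j) * ρ ^ (j : ℕ)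
  have hmap : ∀ σ : adjoin ℚ {ζ, r} →ₐ[ℚ] ℂ,
      σ x = ∑ j : Fin n, aeval (σ z) (P j) * σ ρ ^ (j : ℕ) := by
    intro σ
    simp only [x, map_sum, map_mul, map_pow]
    exact sum_congr rfl fun j _ => congrArg (· * _) (map_aeval_int σ.toRingHom z (P j))
  have hx : (x : ℂ) = ∑ j : Fin n, aeval ζ (P j) * r ^ (j : ℕ) := hmap (IntermediateField.val _)
  have hrank : (finrank ℚ (adjoin ℚ {ζ, r}) : ℝ) = n * n.totient := by
    rw [(finrank_adjoin_radical_le hn hζ hr (F := ℚ) hb).antisymm hdim]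
    push_cast
    ring
  have hsum : ∑ σ : adjoin ℚ {ζ, r} →ₐ[ℚ] ℂ, ‖σ x‖ ^ 2
      = n * ∑ j : Fin n, ‖r ^ (j : ℕ)‖ ^ 2 * conjSqSum n (P j) := by
    let G : ℂ × ℂ → ℝ := fun q =>
      ‖∑ j : Fin n, aeval q.1 (P j) * r ^ (j : ℕ) * q.2 ^ (j : ℕ)‖ ^ 2
    have hG : ∀ σ : adjoin ℚ {ζ, r} →ₐ[ℚ] ℂ, ‖σ x‖ ^ 2 = G (radicalPair σ) := by
      intro σ
      simp only [G, radicalPair, hmap, mul_assoc, ← mul_pow, mul_div_cancel₀ _ hr]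
      rfl
    refine (sum_congr rfl fun σ _ => hG σ).trans
      ((sum_radicalPair hn hζ hr (F := ℚ) hb hdim G).trans ?_)
    rw [sum_product]
    simp only [G, sum_nthRootsFinset_norm_sq hn, norm_mul, mul_pow, conjSqSum, mul_sum]
    rw [sum_comm]
    exact sum_congr rfl fun _ _ => sum_congr rfl fun _ _ => by ring
  have hn0 : (n : ℝ) ≠ 0 := Nat.cast_ne_zero.2 hn.ne'
  refine mul_left_cancel₀ hn0 ?_
  rw [← mul_assoc, ← hrank, ← hx, finrank_mul_meanSq, hsum]

theorem isCyclotomicExtension_adjoin_simple {n : ℕ} (hn : 0 < n) {ζ : ℂ}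
    (hζ : IsPrimitiveRoot ζ n) : IsCyclotomicExtension {n} ℚ ℚ⟮ζ⟯ := by
  have : NeZero n := ⟨hn.ne'⟩
  change IsCyclotomicExtension {n} ℚ ℚ⟮ζ⟯.toSubalgebra
  rw [adjoin_simple_toSubalgebra_of_isAlgebraic (hζ.isIntegral hn).tower_top.isAlgebraic]
  exact hζ.adjoin_isCyclotomicExtension ℚ

theorem totient_mul_meanSq_aeval {n : ℕ} (hn : 0 < n) {ζ : ℂ} (hζ : IsPrimitiveRoot ζ n)
    (P : ℤ[X]) : n.totient * meanSq (aeval ζ P) = conjSqSum n P := by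
  have : NeZero n := ⟨hn.ne'⟩
  have := isCyclotomicExtension_adjoin_simple hn hζ
  have := IsCyclotomicExtension.finiteDimensional {n} ℚ ℚ⟮ζ⟯
  have hirr := cyclotomic.irreducible_rat hn
  let z : ℚ⟮ζ⟯ := AdjoinSimple.gen ℚ ζ
  have hz : IsPrimitiveRoot z n := IsPrimitiveRoot.coe_submonoidClass_iff.1 hζ
  calc n.totient * meanSq (aeval ζ P)
      = finrank ℚ ℚ⟮ζ⟯ * meanSq (aeval z P : ℚ⟮ζ⟯) := by
        rw [IsCyclotomicExtension.finrank ℚ⟮ζ⟯ hirr]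
        exact congrArg (_ * meanSq ·)
          (map_aeval_int (IntermediateField.val ℚ⟮ζ⟯).toRingHom z P).symm
    _ = ∑ σ : ℚ⟮ζ⟯ →ₐ[ℚ] ℂ, ‖σ (aeval z P)‖ ^ 2 := finrank_mul_meanSq _ _
    _ = ∑ w : primitiveRoots n ℂ, ‖aeval (w : ℂ) P‖ ^ 2 :=
        Fintype.sum_equiv (hz.embeddingsEquivPrimitiveRoots ℂ hirr) _ _ fun σ => by
          rw [hz.embeddingsEquivPrimitiveRoots_apply_coe]
          exact congrArg (‖·‖ ^ 2) (map_aeval_int σ.toRingHom z P)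
    _ = conjSqSum n P := sum_coe_sort (primitiveRoots n ℂ) fun w => ‖aeval w P‖ ^ 2

theorem exists_aeval_eq_of_isIntegral {n : ℕ} (hn : 0 < n) {ζ : ℂ} (hζ : IsPrimitiveRoot ζ n)
    {x : ℂ} (hx : x ∈ ℚ⟮ζ⟯) (hint : IsIntegral ℤ x) : ∃ P : ℤ[X], aeval ζ P = x := by
  have : NeZero n := ⟨hn.ne'⟩
  have := isCyclotomicExtension_adjoin_simple hn hζ
  let z : ℚ⟮ζ⟯ := AdjoinSimple.gen ℚ ζ
  have hz : IsPrimitiveRoot z n := IsPrimitiveRoot.coe_submonoidClass_iff.1 hζ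
  have hclosure := IsCyclotomicExtension.Rat.isIntegralClosure_adjoin_singleton hz
  have hint' : IsIntegral ℤ (⟨x, hx⟩ : ℚ⟮ζ⟯) := coe_isIntegral_iff.1 hint
  obtain ⟨⟨w, hw⟩, hwx⟩ := hclosure.isIntegral_iff.1 hint'
  rw [Algebra.adjoin_singleton_eq_range_aeval] at hw
  obtain ⟨P, hP⟩ := hw
  refine ⟨P, ?_⟩
  rw [← show (IntermediateField.val ℚ⟮ζ⟯).toRingHom z = ζ from rfl, ← map_aeval_int]
  exact congrArg Subtype.val (hP.trans hwx)

end MeanSquareRadical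

section Roots

theorem isPrimitiveRoot_zeta {n : ℕ} (hn : n ≠ 0) : IsPrimitiveRoot (zeta n) n :=
  Complex.isPrimitiveRoot_exp n hn

theorem zeta_eq_zeta_mul_pow {d : ℕ} (hd : d ≠ 0) (n : ℕ) : zeta n = zeta (n * d) ^ d := by
  have : (d : ℂ) ≠ 0 := Nat.cast_ne_zero.2 hd
  rw [zeta, zeta, ← Complex.exp_nat_mul]
  congr 1
  push_cast
  field_simp

theorem realRoot_pos (a : ℕ) [NeZero a] (n k : ℕ) : 0 < realRoot a n k :=
  Real.rpow_pos_of_pos (Nat.cast_pos.2 (NeZero.pos a)) _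

theorem one_le_realRoot (a : ℕ) [NeZero a] (n k : ℕ) : 1 ≤ realRoot a n k :=
  Real.one_le_rpow (by exact_mod_cast NeZero.one_le) (by positivity)

theorem ofReal_realRoot_eq_pow (a n k : ℕ) :
    (realRoot a n k : ℂ) = (realRoot a n 1 : ℂ) ^ k := by
  rw [← Complex.ofReal_pow, realRoot, realRoot, ← Real.rpow_mul_natCast (Nat.cast_nonneg a),
    Nat.cast_one, one_div_mul_eq_div]

theorem realRoot_eq_realRoot_mul (a : ℕ) {d : ℕ} (hd : d ≠ 0) (n k : ℕ) :
    realRoot a n k = realRoot a (n * d) (k * d) := by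
  rw [realRoot, realRoot, Nat.cast_mul, Nat.cast_mul,
    mul_div_mul_right _ _ (Nat.cast_ne_zero.2 hd)]

theorem ofReal_realRoot_one_pow (a : ℕ) {n : ℕ} (hn : n ≠ 0) :
    (realRoot a n 1 : ℂ) ^ n = a := by
  rw [← ofReal_realRoot_eq_pow, realRoot, div_self (Nat.cast_ne_zero.2 hn), Real.rpow_one,
    Complex.ofReal_natCast]

theorem isIntegral_zeta_pow_mul_realRoot (a : ℕ) {n : ℕ} (hn : n ≠ 0) (l k : ℕ) :
    IsIntegral ℤ (zeta n ^ l * (realRoot a n k : ℂ)) := by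
  have hr : IsIntegral ℤ (realRoot a n 1 : ℂ) :=
    .of_pow (Nat.pos_of_ne_zero hn) (ofReal_realRoot_one_pow a hn ▸ isIntegral_natCast a)
  rw [ofReal_realRoot_eq_pow]
  exact (((isPrimitiveRoot_zeta hn).isIntegral (Nat.pos_of_ne_zero hn)).pow l).mul (hr.pow k)

theorem adjoin_setOf_pow_eq (F : Type*) [Field F] [Algebra F ℂ] (a : ℕ) [NeZero a] {n : ℕ}
    (hn : n ≠ 0) :
    adjoin F {x : ℂ | x ^ n = a} = adjoin F {zeta n, (realRoot a n 1 : ℂ)} := by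
  have : NeZero n := ⟨hn⟩
  have hr : (realRoot a n 1 : ℂ) ≠ 0 := Complex.ofReal_ne_zero.2 (realRoot_pos a n 1).ne'
  have hpow := ofReal_realRoot_one_pow a hn
  have hζ := isPrimitiveRoot_zeta hn
  refine le_antisymm (adjoin_le_iff.2 fun x (hx : x ^ n = a) => ?_) (adjoin_le_iff.2 ?_)
  · obtain ⟨i, -, hi⟩ := hζ.eq_pow_of_pow_eq_one (ξ := x / realRoot a n 1)
      (by rw [div_pow, hx, hpow, div_self (NeZero.ne (a : ℂ))])
    rw [← div_mul_cancel₀ x hr, ← hi]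
    exact mul_mem (pow_mem (subset_adjoin F _ (Set.mem_insert _ _)) i)
      (subset_adjoin F _ (Set.mem_insert_of_mem _ rfl))
  · have hr_mem : (realRoot a n 1 : ℂ) ∈ adjoin F {x : ℂ | x ^ n = a} := subset_adjoin F _ hpow
    have hζr_mem : zeta n * realRoot a n 1 ∈ adjoin F {x : ℂ | x ^ n = a} :=
      subset_adjoin F _ (by rw [Set.mem_ofPred_eq, mul_pow, hζ.pow_eq_one, one_mul, hpow])
    rintro x (rfl | rfl)
    · exact mul_div_cancel_right₀ (zeta n) hr ▸ div_mem hζr_mem hr_mem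
    · exact hr_mem

end Roots

section Qa

theorem finiteDimensional_Qa (a : ℕ) [NeZero a] {n : ℕ} (hn : n ≠ 0) :
    FiniteDimensional ℚ (Qa a n) := by
  rw [Qa, adjoin_setOf_pow_eq ℚ a hn]
  exact finiteDimensional_adjoin_radical (F := ℚ) (b := (a : ℚ)) (Nat.pos_of_ne_zero hn)
    (isPrimitiveRoot_zeta hn) (by simpa using ofReal_realRoot_one_pow a hn)

theorem Qa_one (a : ℕ) : Qa a 1 = ⊥ := by
  refine le_bot_iff.1 (adjoin_le_iff.2 fun z (hz : z ^ 1 = a) => ?_)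
  rw [← pow_one z, hz]
  exact _root_.natCast_mem _ a

theorem Qa_one_left {n : ℕ} (hn : n ≠ 0) : Qa 1 n = ℚ⟮zeta n⟯ := by
  have hroot : (realRoot 1 n 1 : ℂ) = 1 := by simp [realRoot]
  rw [Qa, adjoin_setOf_pow_eq ℚ 1 hn, hroot]
  refine le_antisymm (adjoin_le_iff.2 ?_) (adjoin.mono ℚ _ _ (by simp))
  rintro x (rfl | rfl)
  · exact mem_adjoin_simple_self ℚ _
  · exact one_mem _

theorem extendScalars_Qa_mul {a : ℕ} [NeZero a] {m p n : ℕ} (hnm : n = m * p) (hn : n ≠ 0)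
    (hmp : m.Coprime p) (h : Qa a m ≤ Qa a n) :
    extendScalars h = adjoin (Qa a m) {x : ℂ | x ^ p = a} := by
  subst hnm
  refine (extendScalars_adjoin h).trans
    (le_antisymm (adjoin_le_iff.2 fun z (hz : z ^ (m * p) = a) => ?_)
      (adjoin_le_iff.2 fun z (hz : z ^ p = a) => ?_))
  · have hz0 : z ≠ 0 := (pow_ne_zero_iff hn).1 (hz ▸ NeZero.ne (a : ℂ))
    have hpow_m : z ^ m ∈ adjoin (Qa a m) {x : ℂ | x ^ p = a} :=
      subset_adjoin _ _ (by rw [Set.mem_ofPred_eq, ← pow_mul, hz])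
    have hpow_p : z ^ p ∈ Qa a m :=
      subset_adjoin _ _ (by rw [Set.mem_ofPred_eq, ← pow_mul, mul_comm, hz])
    have hbezout : z = (z ^ m) ^ m.gcdA p * (z ^ p) ^ m.gcdB p := by
      rw [← zpow_natCast, ← zpow_natCast, ← zpow_mul, ← zpow_mul, ← zpow_add₀ hz0,
        ← Nat.gcd_eq_gcd_ab, hmp.gcd_eq_one, Nat.cast_one, zpow_one]
    rw [hbezout]
    exact mul_mem (zpow_mem hpow_m _)
      (zpow_mem (_root_.algebraMap_mem _ (⟨_, hpow_p⟩ : Qa a m)) _)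
  · exact extendScalars_adjoin h ▸ Qa_mono a (Dvd.intro_left m rfl) hn (subset_adjoin ℚ _ hz)

theorem finrank_extendScalars_Qa_mul_le {a : ℕ} [NeZero a] {m p n : ℕ} (hnm : n = m * p)
    (hn : n ≠ 0) (hmp : m.Coprime p) (h : Qa a m ≤ Qa a n) :
    finrank (Qa a m) (extendScalars h) ≤ p.totient * p := by
  have hp : p ≠ 0 := right_ne_zero_of_mul (hnm ▸ hn)
  rw [extendScalars_Qa_mul hnm hn hmp h, adjoin_setOf_pow_eq (Qa a m) a hp]
  exact finrank_adjoin_radical_le (b := (a : Qa a m)) (Nat.pos_of_ne_zero hp)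
    (isPrimitiveRoot_zeta hp) (Complex.ofReal_ne_zero.2 (realRoot_pos a p 1).ne')
    (by simpa using ofReal_realRoot_one_pow a hp)

theorem finiteDimensional_extendScalars {K L : IntermediateField ℚ ℂ} [FiniteDimensional ℚ L]
    (h : K ≤ L) : FiniteDimensional K (extendScalars h) := by
  have : FiniteDimensional ℚ (extendScalars h) := ‹FiniteDimensional ℚ L›
  exact .right ℚ K (extendScalars h)

end Qa

section CoefficientBounds

theorem sum_conjSqSum_le_totient_mul_meanSq {a : ℕ} [NeZero a] {n : ℕ} (hn : n ≠ 0)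
    (hdim : n.totient * n ≤ finrank ℚ (Qa a n)) (P : Fin n → ℤ[X]) :
    ∑ j, conjSqSum n (P j)
      ≤ n.totient * meanSq (∑ j : Fin n, aeval (zeta n) (P j) * (realRoot a n j : ℂ)) := by
  rw [Qa, adjoin_setOf_pow_eq ℚ a hn] at hdim
  have hmeanSq := totient_mul_meanSq_sum_radical (b := (a : ℚ)) (Nat.pos_of_ne_zero hn)
    (isPrimitiveRoot_zeta hn) (Complex.ofReal_ne_zero.2 (realRoot_pos a n 1).ne')
    (by simpa using ofReal_realRoot_one_pow a hn) hdim P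
  simp only [← ofReal_realRoot_eq_pow] at hmeanSq
  rw [hmeanSq]
  refine sum_le_sum fun j _ => le_mul_of_one_le_left (conjSqSum_nonneg n _) (one_le_pow₀ ?_)
  rw [Complex.norm_real]
  exact (one_le_realRoot a n j).trans (le_abs_self _)

end CoefficientBounds

section Discriminant

variable {F K : Type*} [Field F] [Field K] [Algebra F K] {ι : Type*} [Fintype ι] [DecidableEq ι]

theorem cramer_traceMatrix (B : Basis ι F K) (x : K) :
    (Algebra.traceMatrix F B).cramer (fun i => Algebra.trace F K (x * B i))
      = Algebra.discr F B • B.equivFun x := by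
  rw [Matrix.cramer_eq_adjugate_mulVec, ← Algebra.traceMatrix_of_basis_mulVec B x,
    Matrix.mulVec_mulVec, Matrix.adjugate_mul, Matrix.smul_mulVec, Matrix.one_mulVec,
    Algebra.discr_def]

theorem exists_isIntegral_sum_eq_discr_smul [FiniteDimensional F K] {b : ι → K}
    (hb : ∀ i, IsIntegral ℤ (b i)) (hcard : finrank F K ≤ Fintype.card ι) {x : K}
    (hx : IsIntegral ℤ x) :
    ∃ c : ι → F, (∀ i, IsIntegral ℤ (c i)) ∧ ∑ i, c i • b i = Algebra.discr F b • x := by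
  by_cases hli : LinearIndependent F b
  · obtain ⟨B, rfl⟩ : ∃ B : Basis ι F K, ⇑B = b :=
      ⟨_, coe_basisOfLinearIndependentOfCardEqFinrank' b hli
        (hli.fintype_card_le_finrank.antisymm hcard)⟩
    refine ⟨Algebra.discr F B • B.equivFun x, fun i => ?_, ?_⟩
    · rw [← cramer_traceMatrix, Matrix.cramer_apply]
      refine IsIntegral.det fun k l => ?_
      rw [Matrix.updateCol_apply]
      split_ifs
      · exact Algebra.isIntegral_trace (hx.mul (hb k))
      · exact Algebra.isIntegral_trace ((hb k).mul (hb l))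
    · simp only [Pi.smul_apply, smul_assoc, ← smul_sum, B.sum_equivFun]
  · rw [Algebra.discr_zero_of_not_linearIndependent F hli]
    exact ⟨0, fun _ => isIntegral_zero, by simp⟩

theorem exists_isIntegral_mul_eq_norm {Ω : Type*} [Field Ω] [IsAlgClosed Ω] [Algebra F Ω]
    [FiniteDimensional F K] [Algebra.IsSeparable F K] {y : K} (hy : IsIntegral ℤ y)
    (τ : K →ₐ[F] Ω) :
    ∃ q : Ω, IsIntegral ℤ q ∧ q * τ y = algebraMap F Ω (Algebra.norm F y) := by
  classical
  refine ⟨∏ σ ∈ univ.erase τ, σ y, .prod _ fun σ _ => hy.map σ.toRingHom.toIntAlgHom, ?_⟩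
  rw [Algebra.norm_eq_prod_embeddings, prod_erase_mul _ _ (mem_univ τ)]

end Discriminant

section ClearsDenominators

/-- Multiplication by `c` sends the algebraic integers of `K` into the subring `R` of `ℂ`. -/
def ClearsDenominators (c : ℂ) (K : IntermediateField ℚ ℂ) (R : Subring ℂ) : Prop :=
  ∀ x ∈ K, IsIntegral ℤ x → c * x ∈ R

variable {K L E : IntermediateField ℚ ℂ} {ι : Type} [Fintype ι] [DecidableEq ι] {b : ι → L}

theorem exists_isIntegral_mul_eq_norm_inclusion [FiniteDimensional ℚ E] (h : K ≤ E) {d : K}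
    (hd : IsIntegral ℤ d) :
    ∃ q ∈ K, IsIntegral ℤ q ∧ q * d = (Algebra.norm ℚ (inclusion h d) : ℚ) := by
  by_cases hd0 : d = 0
  · exact ⟨0, zero_mem K, isIntegral_zero, by simp [hd0]⟩
  obtain ⟨q, hq, hqd⟩ := exists_isIntegral_mul_eq_norm
    (hd.map (inclusion h).toRingHom.toIntAlgHom) (IntermediateField.val E)
  replace hqd : q * d = (Algebra.norm ℚ (inclusion h d) : ℚ) := hqd
  refine ⟨q, ?_, hq, hqd⟩
  rw [(eq_div_iff (ZeroMemClass.coe_eq_zero.not.2 hd0)).2 hqd]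
  exact div_mem (_root_.algebraMap_mem K _) d.2

theorem isIntegral_relDisc [FiniteDimensional ℚ L] (h : K ≤ L)
    (hb : ∀ i, IsIntegral ℤ (b i : ℂ)) : IsIntegral ℤ (relDisc h b) := by
  have := finiteDimensional_extendScalars h
  exact Algebra.discr_isIntegral K fun i => coe_isIntegral_iff.1 (hb i)

theorem exists_isIntegral_sum_eq_relDisc_mul [FiniteDimensional ℚ L] (h : K ≤ L)
    (hb : ∀ i, IsIntegral ℤ (b i : ℂ)) (hrank : finrank K (extendScalars h) ≤ Fintype.card ι)
    {x : ℂ} (hx : x ∈ L) (hint : IsIntegral ℤ x) :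
    ∃ c : ι → K, (∀ i, IsIntegral ℤ (c i : ℂ)) ∧ ∑ i, (c i : ℂ) * b i = relDisc h b * x := by
  have := finiteDimensional_extendScalars h
  obtain ⟨c, hc, hcb⟩ := exists_isIntegral_sum_eq_discr_smul
    (b := fun i => (⟨b i, (b i).2⟩ : extendScalars h)) (fun i => coe_isIntegral_iff.1 (hb i)) hrank
    (x := ⟨x, hx⟩) (coe_isIntegral_iff.1 hint)
  refine ⟨c, fun i => coe_isIntegral_iff.2 (hc i), ?_⟩
  simpa [Algebra.smul_def, relDisc] using congrArg (IntermediateField.val (extendScalars h)) hcb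

theorem ClearsDenominators.mul_norm_relDisc [FiniteDimensional ℚ L] [FiniteDimensional ℚ E]
    {c : ℂ} {R : Subring ℂ} (hc : ClearsDenominators c K R) (hKL : K ≤ L) (hKE : K ≤ E)
    (hb : ∀ i, IsIntegral ℤ (b i : ℂ)) (hbR : ∀ i, (b i : ℂ) ∈ R)
    (hrank : finrank K (extendScalars hKL) ≤ Fintype.card ι) :
    ClearsDenominators (c * (Algebra.norm ℚ (inclusion hKE (relDisc hKL b)) : ℚ)) L R := by
  intro x hx hint
  obtain ⟨q, hqK, hq, hnorm⟩ :=
    exists_isIntegral_mul_eq_norm_inclusion hKE (isIntegral_relDisc hKL hb)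
  obtain ⟨d, hd, hsum⟩ := exists_isIntegral_sum_eq_relDisc_mul hKL hb hrank hx hint
  rw [← hnorm, mul_assoc, mul_assoc, ← hsum, mul_sum, mul_sum]
  refine sum_mem fun i _ => ?_
  rw [← mul_assoc q, ← mul_assoc c]
  exact mul_mem (hc _ (mul_mem hqK (d i).2) (hq.mul (hd i))) (hbR i)

theorem finrank_mul_card_le_of_relDisc_ne_zero [FiniteDimensional ℚ L] (h : K ≤ L)
    (hd : relDisc h b ≠ 0) : finrank ℚ K * Fintype.card ι ≤ finrank ℚ L := by
  have := finiteDimensional_extendScalars h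
  have hli : LinearIndependent K fun i => (⟨b i, (b i).2⟩ : extendScalars h) :=
    not_imp_comm.1 (Algebra.discr_zero_of_not_linearIndependent K) hd
  rw [← finrank_bot_mul_relfinrank h, relfinrank_eq_finrank_of_le h]
  exact Nat.mul_le_mul_left _ hli.fintype_card_le_finrank

end ClearsDenominators

section Tower

variable {N : ℕ}

theorem below_ne_zero (N t : ℕ) : below N t ≠ 0 :=
  prod_ne_zero_iff.2 fun _ hq =>
    pow_ne_zero _ (Nat.prime_of_mem_primeFactors (mem_filter.1 hq).1).ne_zero

theorem coprime_below {p : ℕ} (hp : p.Prime) : (below N p).Coprime p :=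
  .prod_left fun _ hq => .pow_left _ <| (Nat.coprime_primes
    (Nat.prime_of_mem_primeFactors (mem_filter.1 hq).1) hp).2 (mem_filter.1 hq).2.ne

theorem below_eq_prod_subtype (N t : ℕ) :
    below N t = ∏ p : N.primeFactors with p.1 < t, p.1 ^ N.factorization p.1 := by
  rw [below, prod_filter, prod_filter, prod_coe_sort N.primeFactors
    fun q => if q < t then q ^ N.factorization q else 1]

theorem filter_lt_succ_of_mem {s : Finset ℕ} {p : ℕ} (hp : p ∈ s) :
    univ.filter (fun q : s => q.1 < p + 1) = insert ⟨p, hp⟩ (univ.filter fun q : s => q.1 < p) := by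
  ext q
  simp only [mem_filter, mem_univ, true_and, mem_insert, Subtype.ext_iff]
  omega

theorem filter_lt_succ_of_notMem {s : Finset ℕ} {p : ℕ} (hp : p ∉ s) :
    univ.filter (fun q : s => q.1 < p + 1) = univ.filter fun q : s => q.1 < p := by
  refine filter_congr fun q _ => ?_
  have : q.1 ≠ p := fun h => hp (h ▸ q.2)
  omega

theorem prod_fin_induction {M : Type*} [CommMonoid M] {P : ℕ → M → Prop} {c : M} (zero : P 0 c)
    {k : ℕ} (f : Fin k → M) (succ : ∀ (s : Fin k) (d : M), P s d → P (s + 1) (d * f s)) :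
    P k (c * ∏ s, f s) := by
  induction k with
  | zero => simpa using zero
  | succ k ih =>
    rw [Fin.prod_univ_castSucc, ← mul_assoc]
    exact succ (Fin.last k) _ (ih (fun s => f s.castSucc) fun s => succ s.castSucc)

theorem norm_discProd_induction (a : ℕ) [NeZero a] (hN : N ≠ 0) {P : ℕ → ℚ → Prop} (one : P 1 1)
    (mul : ∀ (p : N.primeFactors) (s : Fin (N.factorization p)) (c : ℚ),
      P (below N p * p.1 ^ (s : ℕ)) c →
      P (below N p * p.1 ^ ((s : ℕ) + 1)) (c * Algebra.norm ℚ (inclusion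
        (Qa_mono a (below_mul_pow_dvd p.2 s.2.le) hN) (stepDisc a N p s)))) :
    P N (Algebra.norm ℚ (discProd a N)) := by
  let f (p : N.primeFactors) : ℚ := ∏ s : Fin (N.factorization p), Algebra.norm ℚ (inclusion
    (Qa_mono a (below_mul_pow_dvd p.2 s.2.le) hN) (stepDisc a N p s))
  have hbelow : ∀ t, P (below N t) (∏ p : N.primeFactors with p.1 < t, f p) := by
    intro t
    induction t with
    | zero => simpa [below] using one
    | succ t ih =>
      rw [below_eq_prod_subtype]
      by_cases ht : t ∈ N.primeFactors
      · rw [filter_lt_succ_of_mem ht, prod_insert (by simp), prod_insert (by simp), mul_comm,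
          mul_comm (f _), ← below_eq_prod_subtype]
        exact prod_fin_induction (P := fun s c => P (below N t * t ^ s) c) (by simpa using ih) _
          (mul ⟨t, ht⟩)
      · rwa [filter_lt_succ_of_notMem ht, ← below_eq_prod_subtype]
  have hlt : univ.filter (fun p : N.primeFactors => p.1 < N + 1) = univ :=
    filter_true_of_mem fun p _ => Nat.lt_succ_of_le (Nat.le_of_mem_primeFactors p.2)
  have hprod : ∏ p : N.primeFactors, p.1 ^ N.factorization p.1 = N :=
    (prod_coe_sort N.primeFactors fun q => q ^ N.factorization q).trans
      (Nat.prod_factorization_pow_eq_self hN)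
  have hnorm : Algebra.norm ℚ (discProd a N) = ∏ p, f p := by
    simp only [discProd, map_prod, f]
  have htop := hbelow (N + 1)
  rwa [below_eq_prod_subtype, hlt, hprod, ← hnorm] at htop

end Tower

section RadicalRing

/-- The ring `ℤ[ζ_n, a ^ (1 / n)]`. -/
noncomputable def radicalRing (a n : ℕ) : Subring ℂ :=
  (eval₂RingHom (aeval (R := ℤ) (zeta n)).toRingHom (realRoot a n 1 : ℂ)).range

theorem zeta_mem_radicalRing (a : ℕ) {m n : ℕ} (h : m ∣ n) (hn : n ≠ 0) :
    zeta m ∈ radicalRing a n := by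
  obtain ⟨d, rfl⟩ := h
  have hζ : zeta (m * d) ∈ radicalRing a (m * d) := ⟨C X, by simp⟩
  rw [zeta_eq_zeta_mul_pow (right_ne_zero_of_mul hn) m]
  exact pow_mem hζ d

theorem realRoot_mem_radicalRing (a : ℕ) {m n : ℕ} (h : m ∣ n) (hn : n ≠ 0) (k : ℕ) :
    (realRoot a m k : ℂ) ∈ radicalRing a n := by
  obtain ⟨d, rfl⟩ := h
  have hr : (realRoot a (m * d) 1 : ℂ) ∈ radicalRing a (m * d) := ⟨X, by simp⟩
  rw [realRoot_eq_realRoot_mul a (right_ne_zero_of_mul hn) m, ofReal_realRoot_eq_pow]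
  exact pow_mem hr (k * d)

theorem exists_sum_of_mem_radicalRing {a n : ℕ} (hn : n ≠ 0) {x : ℂ} (hx : x ∈ radicalRing a n) :
    ∃ P : Fin n → ℤ[X], x = ∑ j : Fin n, aeval (zeta n) (P j) * (realRoot a n j : ℂ) := by
  obtain ⟨Q, rfl⟩ := hx
  let B : ℤ[X][X] := X ^ n - C (a : ℤ[X])
  have hroot : B.eval₂ (aeval (R := ℤ) (zeta n)).toRingHom (realRoot a n 1 : ℂ) = 0 := by
    simp [B, ofReal_realRoot_one_pow a hn]
  have hdeg : (Q %ₘ B).natDegree < n := by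
    have hB : B.natDegree = n := natDegree_X_pow_sub_C
    refine hB ▸ natDegree_modByMonic_lt Q (monic_X_pow_sub_C _ hn) fun h => hn ?_
    rw [← hB, h, natDegree_one]
  refine ⟨fun j => (Q %ₘ B).coeff j, ?_⟩
  rw [coe_eval₂RingHom, ← eval₂_modByMonic_eq_self_of_root hroot, eval₂_eq_sum_range' _ hdeg,
    sum_range]
  simp only [ofReal_realRoot_eq_pow a n (Fin.val _)]
  rfl

end RadicalRing

section Delta

variable {a N : ℕ} [NeZero a]

theorem clearsDenominators_one (a : ℕ) (R : Subring ℂ) : ClearsDenominators 1 (Qa a 1) R := by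
  intro x hx hint
  rw [Qa_one, mem_bot] at hx
  obtain ⟨q, rfl⟩ := hx
  obtain ⟨c, rfl⟩ := IsIntegrallyClosed.isIntegral_iff.1
    ((isIntegral_algebraMap_iff (algebraMap ℚ ℂ).injective).1 hint)
  simp [intCast_mem]

theorem clearsDenominators_norm_discProd (a : ℕ) [NeZero a] (hN : Squarefree N) :
    ClearsDenominators (Algebra.norm ℚ (discProd a N) : ℚ) (Qa a N) (radicalRing a N) := by
  have := finiteDimensional_Qa a hN.ne_zero
  refine norm_discProd_induction a hN.ne_zero
    (P := fun m c => ClearsDenominators (c : ℚ) (Qa a m) (radicalRing a N))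
    (by simpa using clearsDenominators_one a _) fun p s c hc => ?_
  have hp := Nat.prime_of_mem_primeFactors p.2
  have hs : (s : ℕ) = 0 := Nat.lt_one_iff.1 (s.2.trans_le (hN.natFactorization_le_one p))
  have hn : below N p * p.1 ^ ((s : ℕ) + 1) ≠ 0 :=
    mul_ne_zero (below_ne_zero N p) (pow_ne_zero _ hp.ne_zero)
  have := finiteDimensional_Qa a hn
  have hdvd : p.1 ^ ((s : ℕ) + 1) ∣ N := (Dvd.intro_left _ rfl).trans (below_mul_pow_dvd p.2 s.2)
  have hpow := ne_zero_of_dvd_ne_zero hN.ne_zero hdvd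
  rw [Rat.cast_mul]
  refine hc.mul_norm_relDisc _ _ (fun i => isIntegral_zeta_pow_mul_realRoot a hpow _ _)
    (fun i => mul_mem (pow_mem (zeta_mem_radicalRing a hdvd hN.ne_zero) _)
      (realRoot_mem_radicalRing a hdvd hN.ne_zero _)) ?_
  have hrank := finrank_extendScalars_Qa_mul_le (a := a) (p := p) (by rw [pow_succ, mul_assoc]) hn
    (by simpa [hs] using coprime_below hp) (Qa_mono a (by gcongr; omega) hn)
  simpa [hs, StepIndex, Nat.totient_prime hp] using hrank

theorem totient_mul_le_finrank_Qa (hN : Squarefree N) (hd : Algebra.norm ℚ (discProd a N) ≠ 0) :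
    N.totient * N ≤ finrank ℚ (Qa a N) := by
  have := finiteDimensional_Qa a hN.ne_zero
  refine norm_discProd_induction a hN.ne_zero
    (P := fun m c => c ≠ 0 → m.totient * m ≤ finrank ℚ (Qa a m)) ?_ (fun p s c ih hc => ?_) hd
  · rw [Qa_one, IntermediateField.finrank_bot]
    simp
  have hp := Nat.prime_of_mem_primeFactors p.2
  have hs : (s : ℕ) = 0 := Nat.lt_one_iff.1 (s.2.trans_le (hN.natFactorization_le_one p))
  have := finiteDimensional_Qa a (n := below N p * p.1 ^ ((s : ℕ) + 1))
    (mul_ne_zero (below_ne_zero N p) (pow_ne_zero _ hp.ne_zero))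
  have hdisc : stepDisc a N p s ≠ 0 := fun h => right_ne_zero_of_mul hc (by simp [h])
  refine le_trans ?_ (finrank_mul_card_le_of_relDisc_ne_zero _ hdisc)
  refine le_trans ?_ (Nat.mul_le_mul_right _ (ih (left_ne_zero_of_mul hc)))
  simp only [hs, pow_zero, mul_one, zero_add, pow_one, Nat.totient_mul (coprime_below hp),
    Nat.totient_prime hp, StepIndex, Fintype.card_prod, Fintype.card_fin, if_true]
  exact (mul_mul_mul_comm _ _ _ _).le

theorem clearsDenominators_Delta (ha : a ≠ 1) (hN : Squarefree N) :
    ClearsDenominators (Delta a N) (Qa a N) (radicalRing a N) := by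
  intro x hx hint
  have hmem := clearsDenominators_norm_discProd a hN x hx hint
  rw [Delta, if_neg ha]
  obtain h | h := abs_choice (Algebra.norm ℚ (discProd a N)) <;> rw [h]
  · exact hmem
  · rw [Rat.cast_neg, neg_mul]
    exact neg_mem hmem

theorem exists_sum_conjSqSum_le (hN : Squarefree N) (hΔ : Delta a N ≠ 0) {β : ℂ}
    (hβ : β ∈ Qa a N) (hint : IsIntegral ℤ β) :
    ∃ P : Fin N → ℤ[X],
      Delta a N * β = ∑ j : Fin N, aeval (zeta N) (P j) * (realRoot a N j : ℂ) ∧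
      ∑ j, conjSqSum N (P j) ≤ N.totient * ((Delta a N : ℝ) ^ 2 * meanSq β) := by
  rw [← meanSq_ratCast_mul _ hint.tower_top]
  by_cases ha : a = 1
  · subst ha
    rw [Qa_one_left hN.ne_zero] at hβ
    obtain ⟨P, rfl⟩ := exists_aeval_eq_of_isIntegral (Nat.pos_of_ne_zero hN.ne_zero)
      (isPrimitiveRoot_zeta hN.ne_zero) hβ hint
    have : NeZero N := ⟨hN.ne_zero⟩
    refine ⟨Pi.single 0 P, ?_, ?_⟩
    · rw [sum_eq_single 0 (fun j _ hj => by simp [hj]) (by simp)]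
      simp [Delta, realRoot]
    · rw [sum_eq_single 0 (fun j _ hj => by simp [hj, conjSqSum]) (by simp)]
      simp [Delta, totient_mul_meanSq_aeval (NeZero.pos N) (isPrimitiveRoot_zeta hN.ne_zero)]
  · obtain ⟨P, hP⟩ :=
      exists_sum_of_mem_radicalRing hN.ne_zero (clearsDenominators_Delta ha hN β hβ hint)
    rw [Delta, if_neg ha, abs_ne_zero] at hΔ
    exact ⟨P, hP, hP ▸
      sum_conjSqSum_le_totient_mul_meanSq hN.ne_zero (totient_mul_le_finrank_Qa hN hΔ) P⟩

end Delta

section Conclusion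

variable {a N : ℕ} [NeZero a]

theorem isSumOfRoots_of_isSumOf {β : ℂ} {n : ℕ}
    (h : IsSumOf {y : ℂ | ∃ ξ : ℂ, IsOfFinOrder ξ ∧ ∃ j : Fin N, ξ * (realRoot a N j : ℂ) = y} n
      (Delta a N * β)) :
    IsSumOfRoots a N β n := by
  obtain ⟨y, hy, hsum⟩ := h.exists_fin
  choose ξ hξ j hj using hy
  refine ⟨ξ, j, fun i => isOfFinOrder_iff_pow_eq_one.1 (hξ i), ?_⟩
  rw [← hsum]
  exact sum_congr rfl fun i _ => (hj i).symm

theorem exists_isSumOfRoots_le (hN : Squarefree N) {β : ℂ} (hβ : β ∈ Qa a N)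
    (hint : IsIntegral ℤ β) :
    ∃ n : ℕ, IsSumOfRoots a N β n ∧
      (n : ℝ) ≤ 2 ^ #N.primeFactors * ((Delta a N : ℝ) ^ 2 * meanSq β) := by
  by_cases hΔ : Delta a N = 0
  · exact ⟨0, ⟨Fin.elim0, Fin.elim0, fun i => i.elim0, by simp [hΔ]⟩, by simp [hΔ]⟩
  have hpos := Nat.pos_of_ne_zero hN.ne_zero
  obtain ⟨P, hP, hle⟩ := exists_sum_conjSqSum_le hN hΔ hβ hint
  choose n hn hcassels using fun j => exists_isSumOf_rootsOfUnity hN (P j)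
    ((mem_primitiveRoots hpos).2 (isPrimitiveRoot_zeta hN.ne_zero))
  have hsum : ∀ j : Fin N, IsSumOf
      {y : ℂ | ∃ ξ : ℂ, IsOfFinOrder ξ ∧ ∃ j : Fin N, ξ * (realRoot a N j : ℂ) = y} (n j)
      (aeval (zeta N) (P j) * (realRoot a N j : ℂ)) := fun j =>
    (hn j).map (AddMonoidHom.mulRight (realRoot a N j : ℂ)) fun ξ hξ => ⟨ξ, hξ, j, rfl⟩
  refine ⟨∑ j, n j, isSumOfRoots_of_isSumOf (hP ▸ .sum hsum), ?_⟩
  refine le_of_mul_le_mul_right ?_ (Nat.cast_pos.2 (Nat.totient_pos.2 hpos) : (0 : ℝ) < N.totient)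
  calc ((∑ j, n j : ℕ) : ℝ) * N.totient
      = ∑ j, (n j : ℝ) * N.totient := by rw [Nat.cast_sum, sum_mul]
    _ ≤ ∑ j, 2 ^ #N.primeFactors * conjSqSum N (P j) := sum_le_sum fun j _ => hcassels j
    _ = 2 ^ #N.primeFactors * ∑ j, conjSqSum N (P j) := (mul_sum _ _ _).symm
    _ ≤ 2 ^ #N.primeFactors * (N.totient * ((Delta a N : ℝ) ^ 2 * meanSq β)) := by gcongr
    _ = 2 ^ #N.primeFactors * ((Delta a N : ℝ) ^ 2 * meanSq β) * N.totient := by ring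

theorem squarefree_prod_primes {ι : Type*} {s : Finset ι} {p : ι → ℕ}
    (hp : ∀ i ∈ s, (p i).Prime) (hinj : Set.InjOn p s) : Squarefree (∏ i ∈ s, p i) :=
  squarefree_prod_of_pairwise_isCoprime
    (fun i hi j hj hij => Nat.coprime_iff_isRelPrime.1
      ((Nat.coprime_primes (hp i hi) (hp j hj)).2 (hinj.ne hi hj hij)))
    fun i hi => (hp i hi).prime.squarefree

theorem card_primeFactors_prod_primes {ι : Type*} {s : Finset ι} {p : ι → ℕ}
    (hp : ∀ i ∈ s, (p i).Prime) (hinj : Set.InjOn p s) : #(∏ i ∈ s, p i).primeFactors = #s := by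
  rw [← card_image_of_injOn hinj, ← prod_image (f := fun q => q) hinj,
    Nat.primeFactors_prod (forall_mem_image.2 hp)]

theorem nth_prime_succ_injective : Function.Injective fun r => Nat.nth Nat.Prime (r + 1) :=
  (Nat.nth_injective Nat.infinite_setOfPred_prime).comp (add_left_injective 1)

theorem squarefree_prod_nth_prime (μ : ℕ) :
    Squarefree (∏ r ∈ range μ, Nat.nth Nat.Prime (r + 1)) :=
  squarefree_prod_primes (fun r _ => Nat.prime_nth_prime (r + 1)) nth_prime_succ_injective.injOn

theorem card_primeFactors_prod_nth_prime (μ : ℕ) :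
    #(∏ r ∈ range μ, Nat.nth Nat.Prime (r + 1)).primeFactors = μ :=
  (card_primeFactors_prod_primes (fun r _ => Nat.prime_nth_prime (r + 1))
    nth_prime_succ_injective.injOn).trans (card_range μ)

end Conclusion

end Kummer

theorem lemma5p2_general (a : ℕ) [NeZero a] {N : ℕ} (hN : Squarefree N) {β : ℂ}
    (hβ : β ∈ Kummer.Qa a N) (hint : IsIntegral ℤ β) :
    (∃ n : ℕ, Kummer.IsSumOfRoots a N β n) ∧
      (2 : ℝ)⁻¹ ^ N.primeFactors.card * (Kummer.M a N β : ℝ) ≤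
        (Kummer.Delta a N : ℝ) ^ 2 * Kummer.meanSq β := by
  obtain ⟨n, hn, hle⟩ := Kummer.exists_isSumOfRoots_le hN hβ hint
  have hM : (Kummer.M a N β : ℝ) ≤ n := Nat.cast_le.2 (Nat.sInf_le hn)
  refine ⟨⟨n, hn⟩, ?_⟩
  rw [inv_pow, inv_mul_le_iff₀ (by positivity)]
  exact hM.trans hle

theorem lemma5p2 (a : ℕ) [NeZero a]
    (ha : a = 1 ∨ ¬ ∃ (q : ℚ) (k : ℕ), 2 ≤ k ∧ (a : ℚ) = q ^ k)
    (μ N : ℕ) (hN : N = ∏ r ∈ Finset.range μ, Nat.nth Nat.Prime (r + 1))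
    (β : ℂ) (hβ : β ∈ Kummer.Qa a N) (hint : IsIntegral ℤ β) :
    (∃ n : ℕ, Kummer.IsSumOfRoots a N β n) ∧
      (2 : ℝ)⁻¹ ^ μ * (Kummer.M a N β : ℝ) ≤
        (Kummer.Delta a N : ℝ) ^ 2 * Kummer.meanSq β := by
  subst hN
  simpa only [Kummer.card_primeFactors_prod_nth_prime] using
    lemma5p2_general a (Kummer.squarefree_prod_nth_prime μ) hβ hint
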